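/- Let $H=(V,E)$ be a finite $k$-uniform hypergraph, $k\ge 3$, on $n$ vertices, that is simple (two distinct edges share at most one vertex), with maximum degree $\Delta$. A coloring $X:V\to[q]$ is proper if no edge is monochromatic; let $\mathcal Q$ be the set of proper $q$-colorings. For a coloring $X$ and $v\in V$ let $A(v,X)$ be the set of colors $c$ for which there is no edge $e\ni v$ with $X(x)=c$ for all $x\in e\setminus\{v\}$. A Glauber move takes $X$ to a coloring obtained from $X$ by giving some vertex $v$ some color $c\in A(v,X)$. Let $\Gamma_{\mathcal Q}$ be the graph on $\mathcal Q$ in which two different colorings are adjacent when a Glauber move takes one to the other. Put $\varepsilon=\frac1{50k^2}$, and call a coloring $X$ $\boldsymbol\epsilon$-good if for all $v\in V$ and $1\le i\le k-2$ the number of edges $e\ni v$ such that $X$ uses exactly $i$ colors on $e\setminus\{v\}$ is less than $(\varepsilon q)^i$. For every $k\ge3$ there are constants $C_k$ and $D_k$, depending only on $k$, such that for every $\delta>0$ there is an $N$, depending only on $k$ and $\delta$, with the following property. If $n\ge N$, $q\le 2\Delta$ and $$q\ge\max\{C_k\log n,\;10k\varepsilon^{-1}\Delta^{1/(k-1)}\},$$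 then (i) $\Gamma_{\mathcal Q}$ has a connected component $\mathcal Q_0$ with $|\mathcal Q_0|\ge(1-\delta)|\mathcal Q|$ (a giant component of size $(1-o(1))|\mathcal Q|$); (ii) any two $\boldsymbol\epsilon$-good proper colorings are joined by a path in $\Gamma_{\mathcal Q}$ of length at most $D_k\,n\log n$; (iii) at least $(1-\delta)|\mathcal Q|$ of the proper colorings are $\boldsymbol\epsilon$-good. -/

import Mathlib

namespace HypergraphColoring

/-- `H` is `k`-uniform: every edge is a set of `k` vertices. -/
def IsUniform {V : Type*} (H : Hypergraph V) (k : ℕ) : Prop :=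
  ∀ e ∈ H.edgeSet, e.ncard = k

/-- `H` is simple (linear): two distinct edges meet in at most one vertex. -/
def IsSimple {V : Type*} (H : Hypergraph V) : Prop :=
  ∀ e ∈ H.edgeSet, ∀ f ∈ H.edgeSet, e ≠ f → (e ∩ f).ncard ≤ 1

/-- The degree of `v`: the number of edges that contain `v`. -/
noncomputable def degree {V : Type*} (H : Hypergraph V) (v : V) : ℕ :=
  {e ∈ H.edgeSet | v ∈ e}.ncard

/-- The maximum degree `Δ` of `H`. -/
noncomputable def maxDegree {V : Type*} [Fintype V] (H : Hypergraph V) : ℕ :=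
  Finset.univ.sup (degree H)

/-- A `q`-coloring is proper if every edge contains two vertices of different colors. -/
def IsProper {V : Type*} (H : Hypergraph V) {q : ℕ} (X : V → Fin q) : Prop :=
  ∀ e ∈ H.edgeSet, ∃ x ∈ e, ∃ y ∈ e, X x ≠ X y

/-- The set `𝒬` of proper `q`-colorings of `H`. -/
abbrev ProperColoring {V : Type*} (H : Hypergraph V) (q : ℕ) : Type _ :=
  {X : V → Fin q // IsProper H X}

/-- The set `B(v, X)` of colors that are unavailable to `v`. -/
def unavailable {V : Type*} (H : Hypergraph V) {q : ℕ} (v : V) (X : V → Fin q) :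
    Set (Fin q) :=
  {c | ∃ e ∈ H.edgeSet, v ∈ e ∧ ∀ x ∈ e \ {v}, X x = c}

/-- The set `A(v, X)` of colors that are available to `v`. -/
def available {V : Type*} (H : Hypergraph V) {q : ℕ} (v : V) (X : V → Fin q) :
    Set (Fin q) :=
  (unavailable H v X)ᶜ

/-- One move of the Glauber dynamics can take `X` to `Y`: some vertex `v` is given some color
available to it. (When no color is available to the chosen vertex, the dynamics stays at `X`;
such steps give no edge of a graph.) -/
def GlauberMove {V : Type*} [DecidableEq V] (H : Hypergraph V) {q : ℕ} (X Y : V → Fin q) :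
    Prop :=
  ∃ v : V, ∃ c ∈ available H v X, Y = Function.update X v c

/-- The graph `Γ_𝒬` on the proper `q`-colorings: two different colorings are adjacent if a
Glauber move takes one to the other. -/
def glauberGraph {V : Type*} [DecidableEq V] (H : Hypergraph V) (q : ℕ) :
    SimpleGraph (ProperColoring H q) :=
  SimpleGraph.fromRel fun X Y => GlauberMove H X.1 Y.1

/-- `y_{v,i,X}`: the number of edges `e` containing `v` such that `X` uses exactly `i` colors
on `e \ {v}`. -/
noncomputable def colorCount {V : Type*} (H : Hypergraph V) {q : ℕ} (v : V) (i : ℕ)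
    (X : V → Fin q) : ℕ :=
  {e ∈ H.edgeSet | v ∈ e ∧ (X '' (e \ {v})).ncard = i}.ncard

/-- `ε = 1 / (50 k²)`. -/
noncomputable def eps (k : ℕ) : ℝ := 1 / (50 * (k : ℝ) ^ 2)

/-- `X` is good: `y_{v,i,X} < (ε q) ^ i` for all vertices `v` and all `1 ≤ i ≤ k - 2`. -/
def IsGood {V : Type*} (H : Hypergraph V) (k : ℕ) {q : ℕ} (X : V → Fin q) : Prop :=
  ∀ v : V, ∀ i : ℕ, 1 ≤ i → i ≤ k - 2 → (colorCount H v i X : ℝ) < (eps k * q) ^ i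

end HypergraphColoring

universe u

open HypergraphColoring

/-! Most proper colorings are good by a counting form of the local lemma. Among all functions `V →
Fin q`, let `properOn E q S` be those with no monochromatic edge inside `S`. Adding one vertex to
`S` keeps at least a fraction 1 - 1/(2k) of them (`card_properOn_insert`), so releasing the
constraints that meet k - 1 given vertices gains at most a factor 2. Since `H` is simple, the sets e
\ {v} for the edges e at v are disjoint. Hence in a random proper coloring the events "e sees
exactly i colors" are, up to a factor 2 per edge, dominated by independent events. An exponential
moment and Markov's inequality bound the probability that y_{v,i,X} is too large by n⁻², and a union
bound over v and i gives k/n.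

Good colorings X and Y are joined through a common coloring z: in a fixed order of the vertices,
each vertex receives its color in z, starting once from X and once from Y. If z is chosen vertex by
vertex at random among the colors available in both processes, and there are at least q/2 of these,
then a given color has probability at most 2/q. So an edge at v that initially shows i colors
outside v is monochromatic outside v, when the turn of v comes, with probability at most about
(2/q)^(i-1). Goodness makes the sum of these quantities over the edges at v a small multiple of q,
so v should have few blocked colors.

The choice is derandomized in `exists_common_recoloring`: `vertexPotential` dominates 2 to the
number of blocked colors, does not grow on average, and is summed over all v and both processes.
Keeping the sum below exp(q/8) leaves fewer than q/4 blocked colors in each process, hence q/2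
common choices. The path has length at most 2n, and the component of one good coloring contains all
good colorings. -/

namespace HypergraphColoring

open Finset

/-! ### Counting colorings: independence, local lemma, exponential moments. -/

section Counting

variable {V : Type*} [Fintype V] [DecidableEq V]

/-- Events of a uniformly random function that depend on complementary sets of coordinates are
independent. -/
theorem card_filter_and_mul_card {α : Type*} [Fintype α] [DecidableEq α] (T : Finset V)
    (A B : (V → α) → Prop) [DecidablePred A] [DecidablePred B]
    (hA : ∀ X Y, (∀ u ∈ T, X u = Y u) → A X → A Y)
    (hB : ∀ X Y, (∀ u ∉ T, X u = Y u) → B X → B Y) :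
    #{X | A X ∧ B X} * Fintype.card (V → α) = #{X | A X} * #{X | B X} := by
  rw [← Finset.card_univ, ← card_product, ← card_product]
  -- The involution exchanges the values of the two functions outside `T`.
  refine card_nbij' (fun p => (T.piecewise p.1 p.2, T.piecewise p.2 p.1))
    (fun p => (T.piecewise p.1 p.2, T.piecewise p.2 p.1)) ?_ ?_ ?_ ?_
  · rintro ⟨X, Y⟩ h
    simp only [coe_product, coe_filter, coe_univ, Set.mem_prod, Set.mem_ofPred_eq, mem_univ,
      true_and, Set.mem_univ, and_true] at h ⊢
    exact ⟨hA _ _ (fun u hu => by simp [hu]) h.1, hB _ _ (fun u hu => by simp [hu]) h.2⟩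
  · rintro ⟨X, Y⟩ h
    simp only [coe_product, coe_filter, coe_univ, Set.mem_prod, Set.mem_ofPred_eq, mem_univ,
      true_and, Set.mem_univ, and_true] at h ⊢
    exact ⟨hA _ _ (fun u hu => by simp [hu]) h.1, hB _ _ (fun u hu => by simp [hu]) h.2⟩
  · rintro ⟨X, Y⟩ -
    ext u <;> by_cases hu : u ∈ T <;> simp [hu]
  · rintro ⟨X, Y⟩ -
    ext u <;> by_cases hu : u ∈ T <;> simp [hu]

theorem card_filter_image_card_mul_le (q i : ℕ) (T : Finset V) :
    #{X : V → Fin q | #(T.image X) = i} * q ^ #T ≤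
      q ^ i * i ^ #T * Fintype.card (V → Fin q) := by
  -- Union bound over the set `C` of the i colors used on `T`; there are at most q^i such sets.
  have hsub : ({X : V → Fin q | #(T.image X) = i} : Finset (V → Fin q)) ⊆
      (powersetCard i univ).biUnion
        fun C => Fintype.piFinset fun u => if u ∈ T then C else univ := by
    intro X hX
    simp only [mem_filter, mem_univ, true_and] at hX
    refine mem_biUnion.2 ⟨T.image X, mem_powersetCard.2 ⟨subset_univ _, hX⟩, ?_⟩
    refine Fintype.mem_piFinset.2 fun u => ?_
    split_ifs with hu
    · exact mem_image_of_mem _ hu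
    · exact mem_univ _
  have hcard : ∀ C ∈ powersetCard i (univ : Finset (Fin q)),
      #(Fintype.piFinset fun u => if u ∈ T then C else univ) ≤ i ^ #T * q ^ #Tᶜ := by
    intro C hC
    rw [Fintype.card_piFinset, ← prod_mul_prod_compl T]
    refine le_of_eq ?_
    congr 1
    · rw [prod_congr rfl (g := fun _ => i)]
      · simp
      · intro u hu
        simp [hu, (mem_powersetCard.1 hC).2]
    · rw [prod_congr rfl (g := fun _ => q)]
      · simp
      · intro u hu
        simp [mem_compl.1 hu]
  have h1 : #{X : V → Fin q | #(T.image X) = i} ≤ q ^ i * (i ^ #T * q ^ #Tᶜ) := by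
    refine (card_le_card hsub).trans ((card_biUnion_le_card_mul _ _ _ hcard).trans ?_)
    gcongr
    rw [card_powersetCard, card_univ, Fintype.card_fin]
    exact Nat.choose_le_pow q i
  have h2 : Fintype.card (V → Fin q) = q ^ #Tᶜ * q ^ #T := by
    rw [← pow_add, Fintype.card_fun, Fintype.card_fin, card_compl,
      Nat.sub_add_cancel (card_le_univ T)]
  rw [h2]
  calc _ ≤ q ^ i * (i ^ #T * q ^ #Tᶜ) * q ^ #T := by gcongr
    _ = _ := by ring

/-- Prescribing that exactly `i` colors occur on `T` is at least as restrictive as for a uniform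
coloring, for a property that does not depend on the colors in `T`. -/
theorem card_filter_image_card_and_mul_le {q : ℕ} (hq : 0 < q) (i : ℕ) (T : Finset V)
    (B : (V → Fin q) → Prop) [DecidablePred B]
    (hB : ∀ X Y, (∀ u ∉ T, X u = Y u) → B X → B Y) :
    #{X : V → Fin q | #(T.image X) = i ∧ B X} * q ^ #T ≤
      q ^ i * i ^ #T * #{X : V → Fin q | B X} := by
  have hN : 0 < Fintype.card (V → Fin q) := by
    rw [Fintype.card_fun, Fintype.card_fin]; positivity
  have h1 := card_filter_and_mul_card T (fun X : V → Fin q => #(T.image X) = i) B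
    (fun X Y h hX => by rw [← hX, image_congr (fun u hu => h u hu)]) hB
  have h2 := card_filter_image_card_mul_le q i T
  refine Nat.le_of_mul_le_mul_right ?_ hN
  calc _ = #{X : V → Fin q | #(T.image X) = i ∧ B X} * Fintype.card (V → Fin q) * q ^ #T := by
        ring
    _ = #{X : V → Fin q | #(T.image X) = i} * q ^ #T * #{X : V → Fin q | B X} := by
        rw [h1]; ring
    _ ≤ q ^ i * i ^ #T * Fintype.card (V → Fin q) * #{X : V → Fin q | B X} := by gcongr
    _ = _ := by ring

variable (E : Finset (Finset V)) (q : ℕ)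

/-- The colorings of all vertices for which no edge inside `S` is monochromatic. -/
def properOn (S : Finset V) : Finset (V → Fin q) :=
  {X | ∀ e ∈ E, e ⊆ S → #(e.image X) ≠ 1}

variable {E q}

theorem mem_properOn {S : Finset V} {X : V → Fin q} :
    X ∈ properOn E q S ↔ ∀ e ∈ E, e ⊆ S → #(e.image X) ≠ 1 := by
  simp [properOn]

theorem properOn_anti {S T : Finset V} (h : S ⊆ T) : properOn E q T ⊆ properOn E q S :=
  fun _ hX => mem_properOn.2 fun e he hes => mem_properOn.1 hX e he (hes.trans h)

theorem mem_properOn_of_eq_on {S : Finset V} {X Y : V → Fin q} (h : ∀ u ∈ S, X u = Y u)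
    (hX : X ∈ properOn E q S) : Y ∈ properOn E q S := by
  refine mem_properOn.2 fun e he hes => ?_
  rw [← image_congr (f := X) fun u hu => h u (hes hu)]
  exact mem_properOn.1 hX e he hes

/-- The one-vertex estimate is assumed only for sets smaller than `m`, so that the lemma can be used
inside the strong induction that proves this estimate. -/
theorem pow_mul_card_properOn_le {a : ℝ} (ha : 0 ≤ a) {m : ℕ}
    (h : ∀ S : Finset V, #S < m → ∀ v,
      a * #(properOn E q S) ≤ #(properOn E q (insert v S))) (S T : Finset V)
    (hST : Disjoint T S) (hm : #(T ∪ S) ≤ m) :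
    a ^ #T * #(properOn E q S) ≤ #(properOn E q (T ∪ S)) := by
  induction T using Finset.induction_on with
  | empty => simp
  | insert v T hv ih =>
    rw [insert_union] at hm ⊢
    have hd := disjoint_insert_left.1 hST
    have hvn : v ∉ T ∪ S := by simp [hv, hd.1]
    rw [card_insert_of_notMem hvn] at hm
    have h1 := ih hd.2 (by omega)
    have h2 := h (T ∪ S) (by omega) v
    rw [card_insert_of_notMem hv, pow_succ']
    calc _ = a * (a ^ #T * #(properOn E q S)) := by ring
      _ ≤ a * #(properOn E q (T ∪ S)) := by gcongr
      _ ≤ _ := h2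

theorem half_le_one_sub_pow {k : ℕ} (hk : 0 < k) :
    (1 : ℝ) / 2 ≤ (1 - 1 / (2 * k)) ^ (k - 1) := by
  have hk' : (1 : ℝ) ≤ k := by exact_mod_cast hk
  have h0 : (1 : ℝ) / (2 * k) ≤ 1 := by
    rw [div_le_one (by positivity)]; linarith
  have h1 := one_add_mul_le_pow (a := -(1 / (2 * k : ℝ))) (by linarith) (k - 1)
  rw [← sub_eq_add_neg] at h1
  refine le_trans ?_ h1
  have h2 : ((k - 1 : ℕ) : ℝ) ≤ k := by exact_mod_cast Nat.sub_le k 1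
  have h3 : (k : ℝ) * (1 / (2 * k)) = 1 / 2 := by field_simp
  have h4 : ((k - 1 : ℕ) : ℝ) * (1 / (2 * k)) ≤ k * (1 / (2 * k)) := by gcongr
  linarith

/-- A coloring lost on adding v has a monochromatic edge e at v and is proper on S \ e. These two
conditions are independent, and the first has probability q^(1-k). By induction, putting the k - 1
vertices of e \ {v} back costs a factor at most (1 - 1/(2k))^(k-1) ≥ 1/2, so each edge loses at most
2/q^(k-1) of the colorings. At most d edges lose at most 1/(2k) in total. -/
theorem card_properOn_insert {k : ℕ} (hk : 2 ≤ k) (hq : 0 < q) {d : ℝ} (hE : ∀ e ∈ E, #e = k)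
    (hd : ∀ v, (#{e ∈ E | v ∈ e} : ℝ) ≤ d) (hdq : 4 * k * d ≤ (q : ℝ) ^ (k - 1))
    (S : Finset V) (v : V) :
    (1 - 1 / (2 * k) : ℝ) * #(properOn E q S) ≤ #(properOn E q (insert v S)) := by
  have hk' : (2 : ℝ) ≤ k := by exact_mod_cast hk
  have ha : (0 : ℝ) ≤ 1 - 1 / (2 * k) := by
    rw [sub_nonneg, div_le_one (by positivity)]; linarith
  have ha1 : (1 - 1 / (2 * k) : ℝ) ≤ 1 := by
    rw [sub_le_self_iff]; positivity
  have hq' : (0 : ℝ) < q := by exact_mod_cast hq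
  induction hm : #S using Nat.strong_induction_on generalizing S v with
  | _ m ih =>
  by_cases hv : v ∈ S
  · rw [insert_eq_of_mem hv]
    exact mul_le_of_le_one_left (by positivity) ha1
  set N := ({e ∈ E | v ∈ e} : Finset (Finset V)) with hN
  set N' := ({e ∈ N | e ⊆ insert v S} : Finset (Finset V)) with hN'
  have hsub : properOn E q S ⊆ properOn E q (insert v S) ∪
      N'.biUnion fun e => {X | #(e.image X) = 1 ∧ X ∈ properOn E q (S \ e)} := by
    intro X hX
    by_cases hX' : X ∈ properOn E q (insert v S)
    · exact mem_union_left _ hX'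
    refine mem_union_right _ ?_
    rw [mem_properOn] at hX'
    push Not at hX'
    obtain ⟨e, he, hes, h1⟩ := hX'
    refine mem_biUnion.2 ⟨e, ?_, ?_⟩
    · refine mem_filter.2 ⟨mem_filter.2 ⟨he, ?_⟩, hes⟩
      by_contra hve
      exact mem_properOn.1 hX e he ((subset_insert_iff_of_notMem hve).1 hes) h1
    · exact mem_filter.2 ⟨mem_univ _, h1, properOn_anti sdiff_subset hX⟩
  have hbad : ∀ e ∈ N', (#{X : V → Fin q | #(e.image X) = 1 ∧ X ∈ properOn E q (S \ e)} : ℝ) ≤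
      2 * #(properOn E q S) / q ^ (k - 1) := by
    intro e he
    obtain ⟨he, hes⟩ := mem_filter.1 he
    obtain ⟨he, hve⟩ := mem_filter.1 he
    have h1 := card_filter_image_card_and_mul_le hq 1 e (fun X => X ∈ properOn E q (S \ e))
      (fun X Y h => mem_properOn_of_eq_on fun u hu => h u (mem_sdiff.1 hu).2)
    rw [hE e he] at h1
    simp only [pow_one, one_pow, mul_one, filter_univ_mem] at h1
    have h1' : #{X : V → Fin q | #(e.image X) = 1 ∧ X ∈ properOn E q (S \ e)} * q ^ (k - 1) ≤
        #(properOn E q (S \ e)) := by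
      refine Nat.le_of_mul_le_mul_left ?_ hq
      refine le_trans (le_of_eq ?_) h1
      obtain ⟨j, rfl⟩ : ∃ j, k = j + 1 := ⟨k - 1, by omega⟩
      simp only [Nat.add_sub_cancel]
      ring
    have hTS : (e.erase v) ∪ (S \ e) = S := by
      ext u
      simp only [mem_union, mem_erase, mem_sdiff]
      constructor
      · rintro (⟨huv, hue⟩ | h)
        · exact (mem_insert.1 (hes hue)).resolve_left huv
        · exact h.1
      · intro hu
        by_cases hue : u ∈ e
        · exact Or.inl ⟨fun h => hv (h ▸ hu), hue⟩
        · exact Or.inr ⟨hu, hue⟩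
    have h2 := pow_mul_card_properOn_le (E := E) (q := q) ha (m := m)
      (fun S' hS' v' => ih _ hS' S' v' rfl) (S \ e) (e.erase v)
      (disjoint_sdiff.mono_left (erase_subset _ _)) (by rw [hTS, hm])
    rw [hTS, card_erase_of_mem hve, hE e he] at h2
    have h3 := half_le_one_sub_pow (k := k) (by omega)
    have h4 : (1 / 2 : ℝ) * #(properOn E q (S \ e)) ≤ #(properOn E q S) :=
      le_trans (by gcongr) h2
    rw [le_div_iff₀ (by positivity)]
    have h5 : (#{X : V → Fin q | #(e.image X) = 1 ∧ X ∈ properOn E q (S \ e)} : ℝ) *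
      (q : ℝ) ^ (k - 1) ≤ #(properOn E q (S \ e)) := by exact_mod_cast h1'
    linarith
  have hcount : (#(properOn E q S) : ℝ) ≤ #(properOn E q (insert v S)) +
      ∑ e ∈ N', (#{X : V → Fin q | #(e.image X) = 1 ∧ X ∈ properOn E q (S \ e)} : ℝ) := by
    exact_mod_cast (card_le_card hsub).trans
      ((card_union_le _ _).trans (Nat.add_le_add_left card_biUnion_le _))
  have hsum := sum_le_card_nsmul N' _ _ hbad
  rw [nsmul_eq_mul] at hsum
  have hN'd : (#N' : ℝ) ≤ d := le_trans (by exact_mod_cast card_filter_le _ _) (hd v)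
  have hfin : (#N' : ℝ) * (2 * #(properOn E q S) / q ^ (k - 1)) ≤
      1 / (2 * k) * #(properOn E q S) := by
    calc _ ≤ d * (2 * #(properOn E q S) / q ^ (k - 1)) := by gcongr
      _ = (4 * k * d) * (#(properOn E q S) / (2 * k * q ^ (k - 1))) := by field_simp; ring
      _ ≤ (q : ℝ) ^ (k - 1) * (#(properOn E q S) / (2 * k * q ^ (k - 1))) := by gcongr
      _ = _ := by field_simp
  linarith

/-- Proper colorings exist. -/
theorem properOn_univ_nonempty {k : ℕ} (hk : 2 ≤ k) (hq : 0 < q) {d : ℝ}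
    (hE : ∀ e ∈ E, #e = k) (hd : ∀ v, (#{e ∈ E | v ∈ e} : ℝ) ≤ d)
    (hdq : 4 * k * d ≤ (q : ℝ) ^ (k - 1)) : (properOn E q univ).Nonempty := by
  have hk' : (2 : ℝ) ≤ k := by exact_mod_cast hk
  have ha : (0 : ℝ) < 1 - 1 / (2 * k) := by
    rw [sub_pos, div_lt_one (by positivity)]; linarith
  have h := pow_mul_card_properOn_le ha.le (m := #(univ : Finset V))
    (fun S _ v => card_properOn_insert hk hq hE hd hdq S v) ∅ univ (by simp) (by simp)
  rw [union_empty] at h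
  have h0 : (0 : ℝ) < #(properOn E q ∅) := by
    have : (fun _ => ⟨0, hq⟩ : V → Fin q) ∈ properOn E q ∅ := by
      refine mem_properOn.2 fun e he hes => ?_
      have := hE e he
      rw [subset_empty.1 hes, card_empty] at this
      omega
    exact_mod_cast card_pos.2 ⟨_, this⟩
  have h1 : (0 : ℝ) < #(properOn E q univ) := lt_of_lt_of_le (by positivity) h
  exact card_pos.1 (by exact_mod_cast h1)

/-- The sets `s a` are disjoint from each other and from `U`, so the conditions are independent and
can be peeled off one at a time. -/
theorem card_filter_forall_image_card_mul_le (hq : 0 < q) {m : ℕ} (i : ℕ) {ι : Type*}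
    [DecidableEq ι] (I : Finset ι) (s : ι → Finset V) (hs : ∀ a ∈ I, #(s a) = m)
    (hdis : (I : Set ι).PairwiseDisjoint s) (U : Finset V) (hU : ∀ a ∈ I, Disjoint (s a) U) :
    #{X ∈ properOn E q U | ∀ a ∈ I, #((s a).image X) = i} * (q ^ m) ^ #I ≤
      (q ^ i * i ^ m) ^ #I * #(properOn E q U) := by
  induction I using Finset.induction_on with
  | empty => simp
  | insert a I ha ih =>
    have ih' := ih (fun b hb => hs b (mem_insert_of_mem hb))
      (hdis.subset (by simp)) (fun b hb => hU b (mem_insert_of_mem hb))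
    have h := card_filter_image_card_and_mul_le hq i (s a)
      (fun X => X ∈ properOn E q U ∧ ∀ b ∈ I, #((s b).image X) = i) (by
        rintro X Y h ⟨hX, hX'⟩
        refine ⟨mem_properOn_of_eq_on (fun u hu => h u fun hua =>
          disjoint_left.1 (hU a (mem_insert_self _ _)) hua hu) hX, fun b hb => ?_⟩
        rw [← hX' b hb, image_congr]
        intro u hu
        refine (h u fun hua => ?_).symm
        have hab : a ≠ b := fun hab => ha (hab ▸ hb)
        exact disjoint_left.1 (hdis (mem_coe.2 (mem_insert_self _ _))
          (mem_coe.2 (mem_insert_of_mem hb)) hab) hua hu)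
    rw [hs a (mem_insert_self _ _)] at h
    have e1 : ({X : V → Fin q | #((s a).image X) = i ∧ X ∈ properOn E q U ∧
        ∀ b ∈ I, #((s b).image X) = i} : Finset _) =
        ({X ∈ properOn E q U | ∀ b ∈ insert a I, #((s b).image X) = i} : Finset _) := by
      ext X
      simp only [mem_filter, mem_univ, true_and, mem_insert, forall_eq_or_imp]
      tauto
    have e2 : ({X : V → Fin q | X ∈ properOn E q U ∧
        ∀ b ∈ I, #((s b).image X) = i} : Finset _) =
        ({X ∈ properOn E q U | ∀ b ∈ I, #((s b).image X) = i} : Finset _) := by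
      ext X
      simp
    rw [e1, e2] at h
    rw [card_insert_of_notMem ha, pow_succ, pow_succ]
    calc _ = #{X ∈ properOn E q U | ∀ b ∈ insert a I, #((s b).image X) = i} * q ^ m *
          (q ^ m) ^ #I := by ring
      _ ≤ q ^ i * i ^ m * #{X ∈ properOn E q U | ∀ b ∈ I, #((s b).image X) = i} *
          (q ^ m) ^ #I := by gcongr
      _ = q ^ i * i ^ m * (#{X ∈ properOn E q U | ∀ b ∈ I, #((s b).image X) = i} *
          (q ^ m) ^ #I) := by ring
      _ ≤ q ^ i * i ^ m * ((q ^ i * i ^ m) ^ #I * #(properOn E q U)) := by gcongr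
      _ = _ := by ring

omit [Fintype V] in
theorem pairwiseDisjoint_erase {F : Finset (Finset V)}
    (hF : ∀ e ∈ F, ∀ f ∈ F, e ≠ f → #(e ∩ f) ≤ 1) (v : V) (hv : ∀ e ∈ F, v ∈ e) :
    (F : Set (Finset V)).PairwiseDisjoint fun e => e.erase v := by
  intro e he f hf hef
  refine disjoint_left.2 fun u hu hu' => (mem_erase.1 hu).1 ?_
  exact card_le_one.1 (hF e he f hf hef) u
    (mem_inter.2 ⟨(mem_erase.1 hu).2, (mem_erase.1 hu').2⟩) v
    (mem_inter.2 ⟨hv e he, hv f hf⟩)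

/-- The probability, for a uniformly random proper coloring, that every edge of a set of edges at
`v` sees exactly `i` colors outside `v`. -/
theorem card_filter_forall_erase_le {k : ℕ} (hk : 2 ≤ k) (hq : 0 < q) {d : ℝ}
    (hE : ∀ e ∈ E, #e = k) (hsimple : ∀ e ∈ E, ∀ f ∈ E, e ≠ f → #(e ∩ f) ≤ 1)
    (hd : ∀ v, (#{e ∈ E | v ∈ e} : ℝ) ≤ d) (hdq : 4 * k * d ≤ (q : ℝ) ^ (k - 1))
    (v : V) (i : ℕ) (F : Finset (Finset V)) (hF : F ⊆ {e ∈ E | v ∈ e}) :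
    (#{X ∈ properOn E q univ | ∀ e ∈ F, #((e.erase v).image X) = i} : ℝ) ≤
      (2 * q ^ i * i ^ (k - 1) / q ^ (k - 1)) ^ #F * #(properOn E q univ) := by
  have hk' : (2 : ℝ) ≤ k := by exact_mod_cast hk
  have ha : (0 : ℝ) ≤ 1 - 1 / (2 * k) := by
    rw [sub_nonneg, div_le_one (by positivity)]; linarith
  have hq' : (0 : ℝ) < q := by exact_mod_cast hq
  have hFE : ∀ e ∈ F, e ∈ E ∧ v ∈ e := fun e he => mem_filter.1 (hF he)
  have hcard : ∀ e ∈ F, #(e.erase v) = k - 1 := fun e he => by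
    rw [card_erase_of_mem (hFE e he).2, hE e (hFE e he).1]
  have hdis := pairwiseDisjoint_erase (fun e he f hf => hsimple e (hFE e he).1 f (hFE f hf).1) v
    (fun e he => (hFE e he).2)
  -- Dropping the constraints that meet `T` makes the events independent; restoring them costs a
  -- factor 2 for each of the `#F` blocks of k - 1 vertices.
  set T := F.biUnion fun e => e.erase v with hT
  have hTcard : #T = (k - 1) * #F := by
    rw [hT, card_biUnion hdis, sum_congr rfl hcard, sum_const, smul_eq_mul, mul_comm]
  have h1 := card_filter_forall_image_card_mul_le (E := E) hq i F (fun e => e.erase v) hcard hdis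
    (univ \ T) (fun e he => disjoint_sdiff.mono_left
      (subset_biUnion_of_mem (fun e : Finset V => e.erase v) he))
  have h2 := pow_mul_card_properOn_le ha (m := #(univ : Finset V))
    (fun S _ v => card_properOn_insert hk hq hE hd hdq S v) (univ \ T) T disjoint_sdiff
    (card_le_card (subset_univ _))
  rw [union_sdiff_of_subset (subset_univ T), hTcard, pow_mul] at h2
  have h3 : (1 / 2 : ℝ) ^ #F * #(properOn E q (univ \ T)) ≤ #(properOn E q univ) :=
    le_trans (by gcongr; exact half_le_one_sub_pow (by omega)) h2
  have h4 : (#{X ∈ properOn E q univ | ∀ e ∈ F, #((e.erase v).image X) = i} : ℝ) ≤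
      #{X ∈ properOn E q (univ \ T) | ∀ e ∈ F, #((e.erase v).image X) = i} := by
    exact_mod_cast card_le_card (filter_subset_filter _ (properOn_anti (subset_univ _)))
  have h5 : (#{X ∈ properOn E q (univ \ T) | ∀ e ∈ F, #((e.erase v).image X) = i} : ℝ) *
      ((q : ℝ) ^ (k - 1)) ^ #F ≤
      ((q : ℝ) ^ i * (i : ℝ) ^ (k - 1)) ^ #F * #(properOn E q (univ \ T)) := by
    have h1' : #{X ∈ properOn E q (univ \ T) | ∀ e ∈ F, #((e.erase v).image X) = i} *
        (q ^ (k - 1)) ^ #F ≤ (q ^ i * i ^ (k - 1)) ^ #F * #(properOn E q (univ \ T)) := by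
      convert h1
    exact_mod_cast h1'
  rw [div_pow, div_mul_eq_mul_div, le_div_iff₀ (by positivity)]
  have h6 : (#(properOn E q (univ \ T)) : ℝ) ≤ 2 ^ #F * #(properOn E q univ) := by
    rw [one_div, inv_pow, inv_mul_le_iff₀ (by positivity)] at h3
    exact h3
  calc _ ≤ (#{X ∈ properOn E q (univ \ T) | ∀ e ∈ F, #((e.erase v).image X) = i} : ℝ) *
      ((q : ℝ) ^ (k - 1)) ^ #F := by gcongr
    _ ≤ _ := h5
    _ ≤ ((q : ℝ) ^ i * (i : ℝ) ^ (k - 1)) ^ #F * (2 ^ #F * #(properOn E q univ)) := by gcongr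
    _ = _ := by rw [mul_assoc (2 : ℝ), mul_pow (2 : ℝ)]; ring

/-- An exponential moment of the number of edges at `v` that see exactly `i` colors outside
`v`. -/
theorem sum_two_pow_le {k : ℕ} (hk : 2 ≤ k) (hq : 0 < q) {d : ℝ}
    (hE : ∀ e ∈ E, #e = k) (hsimple : ∀ e ∈ E, ∀ f ∈ E, e ≠ f → #(e ∩ f) ≤ 1)
    (hd : ∀ v, (#{e ∈ E | v ∈ e} : ℝ) ≤ d) (hdq : 4 * k * d ≤ (q : ℝ) ^ (k - 1))
    (v : V) (i : ℕ) :
    ∑ X ∈ properOn E q univ, (2 : ℝ) ^ #{e ∈ E | v ∈ e ∧ #((e.erase v).image X) = i} ≤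
      Real.exp (2 * q ^ i * i ^ (k - 1) / q ^ (k - 1) * d) * #(properOn E q univ) := by
  set r : ℝ := 2 * q ^ i * i ^ (k - 1) / q ^ (k - 1) with hr
  have hr0 : 0 ≤ r := by positivity
  set N := ({e ∈ E | v ∈ e} : Finset (Finset V)) with hN
  -- The power of 2 counts the sets `F` of edges at v all of which see i colors, so the moment is a
  -- sum of the joint probabilities already bounded.
  have h1 : ∀ X : V → Fin q, (2 : ℝ) ^ #{e ∈ E | v ∈ e ∧ #((e.erase v).image X) = i} =
      ∑ F ∈ N.powerset, if ∀ e ∈ F, #((e.erase v).image X) = i then (1 : ℝ) else 0 := by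
    intro X
    rw [sum_boole, ← filter_filter]
    have : ({F ∈ N.powerset | ∀ e ∈ F, #((e.erase v).image X) = i} : Finset _) =
        ({e ∈ N | #((e.erase v).image X) = i} : Finset _).powerset := by
      ext F
      simp only [mem_filter, mem_powerset, subset_iff]
      exact ⟨fun h e he => ⟨h.1 he, h.2 e he⟩, fun h => ⟨fun e he => (h he).1,
        fun e he => (h he).2⟩⟩
    rw [this, card_powerset]
    push_cast
    rfl
  calc _ = ∑ F ∈ N.powerset,
        (#{X ∈ properOn E q univ | ∀ e ∈ F, #((e.erase v).image X) = i} : ℝ) := by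
        rw [sum_congr rfl fun X _ => h1 X, sum_comm]
        exact sum_congr rfl fun F _ => by rw [sum_boole]
    _ ≤ ∑ F ∈ N.powerset, r ^ #F * #(properOn E q univ) := by
        refine sum_le_sum fun F hF => ?_
        exact card_filter_forall_erase_le hk hq hE hsimple hd hdq v i F (mem_powerset.1 hF)
    _ = (r + 1) ^ #N * #(properOn E q univ) := by
        rw [← sum_mul, ← sum_pow_mul_eq_add_pow]
        simp
    _ ≤ _ := by
        gcongr
        calc (r + 1) ^ #N ≤ Real.exp r ^ #N := by gcongr; exact Real.add_one_le_exp r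
          _ = Real.exp (r * #N) := by rw [← Real.exp_nat_mul, mul_comm]
          _ ≤ _ := by gcongr; exact hd v

/-- Markov's inequality for the exponential moment. -/
theorem card_filter_le_of_le {k : ℕ} (hk : 2 ≤ k) (hq : 0 < q) {d : ℝ}
    (hE : ∀ e ∈ E, #e = k) (hsimple : ∀ e ∈ E, ∀ f ∈ E, e ≠ f → #(e ∩ f) ≤ 1)
    (hd : ∀ v, (#{e ∈ E | v ∈ e} : ℝ) ≤ d) (hdq : 4 * k * d ≤ (q : ℝ) ^ (k - 1))
    (v : V) (i : ℕ) {m : ℝ} (hrm : 2 * q ^ i * i ^ (k - 1) / q ^ (k - 1) * d ≤ m / 4) :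
    (#{X ∈ properOn E q univ |
      m ≤ (#{e ∈ E | v ∈ e ∧ #((e.erase v).image X) = i} : ℝ)} : ℝ) ≤
      Real.exp (-(m / 4)) * #(properOn E q univ) := by
  have h1 := sum_two_pow_le hk hq hE hsimple hd hdq v i
  have h2 : (#{X ∈ properOn E q univ |
      m ≤ (#{e ∈ E | v ∈ e ∧ #((e.erase v).image X) = i} : ℝ)} : ℝ) * Real.exp (m / 2) ≤
      ∑ X ∈ properOn E q univ, (2 : ℝ) ^ #{e ∈ E | v ∈ e ∧ #((e.erase v).image X) = i} := by
    rw [← nsmul_eq_mul]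
    refine (card_nsmul_le_sum _ _ _ fun X hX => ?_).trans
      (sum_le_sum_of_subset_of_nonneg (filter_subset _ _) fun _ _ _ => by positivity)
    have hX' := (mem_filter.1 hX).2
    have h2 : Real.exp (1 / 2) ≤ 2 := by
      rw [← Real.le_log_iff_exp_le (by norm_num)]
      linarith [Real.log_two_gt_d9]
    calc Real.exp (m / 2) ≤
        Real.exp ((#{e ∈ E | v ∈ e ∧ #((e.erase v).image X) = i} : ℝ) * (1 / 2)) := by
          gcongr; linarith
      _ = Real.exp (1 / 2) ^ #{e ∈ E | v ∈ e ∧ #((e.erase v).image X) = i} := by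
          rw [Real.exp_nat_mul]
      _ ≤ _ := by gcongr
  have h3 : Real.exp (2 * q ^ i * i ^ (k - 1) / q ^ (k - 1) * d) ≤ Real.exp (m / 4) := by gcongr
  rw [← mul_le_mul_iff_left₀ (Real.exp_pos (m / 2))]
  calc _ ≤ _ := h2
    _ ≤ _ := h1
    _ ≤ Real.exp (m / 4) * #(properOn E q univ) := by gcongr
    _ = Real.exp (-(m / 4)) * Real.exp (m / 2) * #(properOn E q univ) := by
        rw [← Real.exp_add]; congr 2; ring
    _ = _ := by ring

end Counting

/-! ### Moving two colorings to a common one. -/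

section Recoloring

variable {V : Type*} [DecidableEq V] {q : ℕ}

/-- The product over a family of vertex sets of one plus the weight of the monochromatic colorings
of the set, when color `c` at vertex `u` has weight `μ u c`. -/
def potential {ι : Type*} (I : Finset ι) (s : ι → Finset V) (μ : V → Fin q → ℝ) : ℝ :=
  ∏ b ∈ I, (1 + ∑ c, ∏ u ∈ s b, μ u c)

omit [DecidableEq V] in
theorem potential_congr {ι : Type*} {I : Finset ι} {s : ι → Finset V} {μ ν : V → Fin q → ℝ}
    (h : ∀ b ∈ I, ∀ u ∈ s b, μ u = ν u) : potential I s μ = potential I s ν := by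
  refine prod_congr rfl fun b hb => ?_
  congr 1
  exact sum_congr rfl fun c _ => prod_congr rfl fun u hu => by rw [h b hb u hu]

omit [DecidableEq V] in
theorem potential_nonneg {ι : Type*} {I : Finset ι} {s : ι → Finset V} {μ : V → Fin q → ℝ}
    (h : ∀ u c, 0 ≤ μ u c) : 0 ≤ potential I s μ :=
  prod_nonneg fun _ _ => add_nonneg zero_le_one
    (sum_nonneg fun _ _ => prod_nonneg fun _ _ => h _ _)

/-- Replacing the constant weights at a vertex by a random color does not increase the potential
on average. -/
theorem sum_potential_update_le {ι : Type*} [DecidableEq ι] (I : Finset ι) (s : ι → Finset V)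
    (hdis : (I : Set ι).PairwiseDisjoint s) {μ : V → Fin q → ℝ} (hμ : ∀ u c, 0 ≤ μ u c) (a : V)
    {p : ℝ} (hp : ∀ c, μ a c = p) (F : Finset (Fin q)) (hF : 1 ≤ #F * p) :
    ∑ c' ∈ F, potential I s (Function.update μ a fun c => if c' = c then 1 else 0) ≤
      #F * potential I s μ := by
  -- By disjointness at most one factor involves `a`. It is affine in the weights at `a`, and the
  -- uniform weight 1/#F of a random color is at most `p`.
  by_cases h : ∃ b ∈ I, a ∈ s b
  · obtain ⟨b, hb, hab⟩ := h
    have hrest : ∀ c' : Fin q, potential (I.erase b) s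
        (Function.update μ a fun c => if c' = c then 1 else 0) = potential (I.erase b) s μ := by
      intro c'
      refine potential_congr fun b' hb' u hu => Function.update_of_ne ?_ _ _
      rintro rfl
      exact disjoint_left.1 (hdis (mem_coe.2 (mem_of_mem_erase hb')) (mem_coe.2 hb)
        (ne_of_mem_erase hb')) hu hab
    have hsplit : ∀ ν : V → Fin q → ℝ, potential I s ν =
        (1 + ∑ c, ν a c * ∏ u ∈ (s b).erase a, ν u c) * potential (I.erase b) s ν := by
      intro ν
      rw [potential, ← mul_prod_erase _ _ hb]
      congr 2
      exact sum_congr rfl fun c _ => (mul_prod_erase _ _ hab).symm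
    set G : Fin q → ℝ := fun c => ∏ u ∈ (s b).erase a, μ u c with hG
    have hG0 : ∀ c, 0 ≤ G c := fun c => prod_nonneg fun _ _ => hμ _ _
    have hupd : ∀ c' : Fin q,
        potential I s (Function.update μ a fun c => if c' = c then 1 else 0) =
          (1 + G c') * potential (I.erase b) s μ := by
      intro c'
      rw [hsplit, hrest]
      congr 2
      rw [Function.update_self]
      simp only [ite_mul, one_mul, zero_mul, sum_ite_eq, mem_univ, if_true]
      refine prod_congr rfl fun u hu => ?_
      rw [Function.update_of_ne (ne_of_mem_erase hu)]
    rw [sum_congr rfl fun c' _ => hupd c', ← sum_mul, hsplit μ, ← mul_assoc]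
    refine mul_le_mul_of_nonneg_right ?_ (potential_nonneg hμ)
    rw [sum_add_distrib, sum_const, nsmul_eq_mul, mul_one, mul_add, mul_one]
    simp only [hp]
    rw [← mul_sum, ← mul_assoc]
    gcongr
    calc ∑ c ∈ F, G c ≤ ∑ c, G c :=
          sum_le_sum_of_subset_of_nonneg (subset_univ _) fun c _ _ => hG0 c
      _ ≤ _ := le_mul_of_one_le_left (sum_nonneg fun c _ => hG0 c) hF
  · push Not at h
    rw [← nsmul_eq_mul, ← sum_const]
    refine le_of_eq (sum_congr rfl fun c' _ => potential_congr fun b hb u hu => ?_)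
    refine Function.update_of_ne ?_ _ _
    rintro rfl
    exact h b hb hu

omit [DecidableEq V] in
/-- The weight of the monochromatic colorings of `T`, when some vertices keep their color and the
others are random, is small if many colors occur on `T`. -/
theorem sum_prod_ite_le (hq : 2 ≤ q) (T : Finset V) (hT : T.Nonempty) (P : V → Prop)
    [DecidablePred P] (X : V → Fin q) :
    ∑ c, ∏ u ∈ T, (if P u then (2 / q : ℝ) else if X u = c then 1 else 0) ≤
      2 * (2 / q : ℝ) ^ (#(T.image X) - 1) := by
  have hq' : (2 : ℝ) ≤ q := by exact_mod_cast hq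
  have hp0 : (0 : ℝ) ≤ 2 / q := by positivity
  have hp1 : (2 / q : ℝ) ≤ 1 := by rw [div_le_one (by linarith)]; exact hq'
  have hsplit : ∀ c, ∏ u ∈ T, (if P u then (2 / q : ℝ) else if X u = c then 1 else 0) =
      (2 / q : ℝ) ^ #{u ∈ T | P u} * ∏ u ∈ T with ¬ P u, if X u = c then 1 else 0 := by
    intro c
    rw [prod_ite, prod_const]
  simp only [hsplit]
  rw [← mul_sum]
  -- If all vertices are random, the q colors give q(2/q)^#T. If the fixed vertices share one color,
  -- only that color contributes, and at least #(T.image X) - 1 vertices are random. Otherwise the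
  -- sum vanishes.
  obtain h | ⟨u₀, hu₀⟩ := ({u ∈ T | ¬ P u} : Finset V).eq_empty_or_nonempty
  · have hTP : #{u ∈ T | P u} = #T := by
      rw [← card_filter_add_card_filter_not (s := T) P, h, card_empty, add_zero]
    rw [h, hTP]
    simp only [prod_empty, sum_const, card_univ, Fintype.card_fin, nsmul_eq_mul, mul_one]
    have h1 : #(T.image X) - 1 ≤ #T - 1 := Nat.sub_le_sub_right card_image_le 1
    have h2 : 0 < #T := hT.card_pos
    obtain ⟨j, hj⟩ : ∃ j, #T = j + 1 := ⟨#T - 1, by omega⟩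
    rw [hj] at h1 ⊢
    rw [pow_succ, mul_assoc, div_mul_cancel₀ _ (by linarith), mul_comm]
    gcongr 2 * ?_
    exact pow_le_pow_of_le_one hp0 hp1 h1
  · by_cases hc : ∀ u ∈ ({u ∈ T | ¬ P u} : Finset V), X u = X u₀
    · have h1 : #(T.image X) ≤ #{u ∈ T | P u} + 1 := by
        have : T.image X ⊆ insert (X u₀) (({u ∈ T | P u} : Finset V).image X) := by
          intro c hcT
          obtain ⟨u, hu, rfl⟩ := mem_image.1 hcT
          by_cases hPu : P u
          · exact mem_insert_of_mem (mem_image_of_mem _ (mem_filter.2 ⟨hu, hPu⟩))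
          · rw [hc u (mem_filter.2 ⟨hu, hPu⟩)]
            exact mem_insert_self _ _
        exact (card_le_card this).trans ((card_insert_le _ _).trans
          (Nat.succ_le_succ card_image_le))
      have h2 : ∑ c, ∏ u ∈ T with ¬ P u, (if X u = c then (1 : ℝ) else 0) ≤ 2 := by
        calc _ ≤ ∑ c, (if X u₀ = c then (1 : ℝ) else 0) := by
              refine sum_le_sum fun c _ => ?_
              split_ifs with h
              · exact prod_le_one (fun _ _ => by split_ifs <;> norm_num)
                  (fun _ _ => by split_ifs <;> norm_num)
              · rw [prod_eq_zero hu₀ (if_neg h)]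
          _ = 1 := by simp
          _ ≤ 2 := by norm_num
      rw [mul_comm]
      refine mul_le_mul h2 (pow_le_pow_of_le_one hp0 hp1 (by omega)) (by positivity) (by norm_num)
    · push Not at hc
      obtain ⟨u, hu, hne⟩ := hc
      rw [sum_eq_zero, mul_zero]
      · positivity
      · intro c _
        by_cases h : X u = c
        · exact prod_eq_zero hu₀ (if_neg fun h' => hne (h.trans h'.symm))
        · exact prod_eq_zero hu (if_neg h)

variable (E : Finset (Finset V))

/-- The colors that are unavailable to `v`. -/
def blocked (v : V) (W : V → Fin q) : Finset (Fin q) :=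
  {c | ∃ e ∈ E, v ∈ e ∧ ∀ x ∈ e.erase v, W x = c}

/-- The coloring that agrees with `z` on the vertices of rank less than `t` and with `X` on the
others. -/
def mixed (ρ : V → ℕ) (z X : V → Fin q) (t : ℕ) (u : V) : Fin q :=
  if ρ u < t then z u else X u

/-- The weights of the colors at `u` at time `t`, as seen from `v`: vertices not before `v` keep
their color in `X`; those before `v` have their color in `z` from time `ρ u + 1` on, and weight
`2 / q` for every color until then. -/
noncomputable def weight (ρ : V → ℕ) (z X : V → Fin q) (t : ℕ) (v u : V) (c : Fin q) : ℝ :=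
  if ρ u < ρ v then if ρ u < t then if z u = c then 1 else 0 else 2 / q
  else if X u = c then 1 else 0

/-- The potential of the edges at `v`. -/
noncomputable def vertexPotential (ρ : V → ℕ) (z X : V → Fin q) (t : ℕ) (v : V) : ℝ :=
  potential {e ∈ E | v ∈ e} (fun e => e.erase v) (weight ρ z X t v)

variable {E}

omit [DecidableEq V] in
theorem weight_nonneg (ρ : V → ℕ) (z X : V → Fin q) (t : ℕ) (v u : V) (c : Fin q) :
    0 ≤ weight ρ z X t v u c := by
  unfold weight
  split_ifs <;> positivity

theorem vertexPotential_nonneg (ρ : V → ℕ) (z X : V → Fin q) (t : ℕ) (v : V) :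
    0 ≤ vertexPotential E ρ z X t v :=
  potential_nonneg (weight_nonneg ρ z X t v)

/-- At the turn of v all weights are indicators of the current coloring, so an edge that is
monochromatic outside v contributes a factor at least 2. Distinct blocked colors come from distinct
such edges. -/
theorem two_pow_card_blocked_le (hE : ∀ e ∈ E, 2 ≤ #e) (ρ : V → ℕ) (z X : V → Fin q) (v : V) :
    (2 : ℝ) ^ #(blocked E v (mixed ρ z X (ρ v))) ≤ vertexPotential E ρ z X (ρ v) v := by
  set W := mixed ρ z X (ρ v) with hW
  have hw : ∀ u c, weight ρ z X (ρ v) v u c = if W u = c then 1 else 0 := by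
    intro u c
    simp only [weight, hW, mixed]
    split_ifs <;> rfl
  set N := ({e ∈ E | v ∈ e} : Finset (Finset V)) with hN
  set M := ({e ∈ N | ∃ c, ∀ x ∈ e.erase v, W x = c} : Finset (Finset V)) with hM
  have hcard : #(blocked E v W) ≤ #M := by
    refine card_le_card_of_forall_subsingleton (fun c e => ∀ x ∈ e.erase v, W x = c) ?_ ?_
    · intro c hc
      obtain ⟨-, e, he, hve, h⟩ := mem_filter.1 hc
      exact ⟨e, mem_filter.2 ⟨mem_filter.2 ⟨he, hve⟩, c, h⟩, h⟩
    · rintro e he c ⟨-, hc⟩ c' ⟨-, hc'⟩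
      obtain ⟨he, hve⟩ := mem_filter.1 (mem_filter.1 he).1
      have : (e.erase v).Nonempty := by
        rw [← card_pos, card_erase_of_mem hve]
        have := hE e he
        omega
      obtain ⟨x, hx⟩ := this
      exact (hc x hx).symm.trans (hc' x hx)
  calc (2 : ℝ) ^ #(blocked E v W) ≤ 2 ^ #M := by gcongr; norm_num
    _ = ∏ e ∈ N, if ∃ c, ∀ x ∈ e.erase v, W x = c then (2 : ℝ) else 1 := by
        rw [prod_ite, prod_const, prod_const_one, mul_one]
    _ ≤ _ := by
        refine prod_le_prod (fun e _ => by split_ifs <;> norm_num) fun e _ => ?_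
        have h0 : ∀ c, 0 ≤ ∏ u ∈ e.erase v, weight ρ z X (ρ v) v u c :=
          fun c => prod_nonneg fun u _ => weight_nonneg _ _ _ _ _ _ _
        split_ifs with h
        · obtain ⟨c, hc⟩ := h
          have h1 : (1 : ℝ) = ∏ u ∈ e.erase v, weight ρ z X (ρ v) v u c :=
            (prod_eq_one fun u hu => by rw [hw, if_pos (hc u hu)]).symm
          have h2 := single_le_sum (fun c _ => h0 c) (mem_univ c)
          linarith
        · exact le_add_of_nonneg_right (sum_nonneg fun c _ => h0 c)

theorem vertexPotential_zero_le (hq : 2 ≤ q) (hE : ∀ e ∈ E, 2 ≤ #e) (ρ : V → ℕ)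
    (z X : V → Fin q) (v : V) :
    vertexPotential E ρ z X 0 v ≤
      Real.exp (∑ e ∈ E with v ∈ e, 2 * (2 / q : ℝ) ^ (#((e.erase v).image X) - 1)) := by
  rw [Real.exp_sum]
  refine prod_le_prod (fun e _ => ?_) fun e he => ?_
  · exact add_nonneg zero_le_one
      (sum_nonneg fun _ _ => prod_nonneg fun _ _ => weight_nonneg _ _ _ _ _ _ _)
  · obtain ⟨he, hve⟩ := mem_filter.1 he
    have hne : (e.erase v).Nonempty := by
      rw [← card_pos, card_erase_of_mem hve]
      have := hE e he
      omega
    have h := sum_prod_ite_le hq (e.erase v) hne (fun u => ρ u < ρ v) X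
    have h1 := Real.add_one_le_exp (2 * (2 / q : ℝ) ^ (#((e.erase v).image X) - 1))
    simp only [weight, Nat.not_lt_zero, if_false]
    linarith

/-- Fixing the color of `a` affects only the potentials of vertices after `a`; simplicity supplies
the disjointness needed for these. -/
theorem sum_vertexPotential_update_le (hsimple : ∀ e ∈ E, ∀ f ∈ E, e ≠ f → #(e ∩ f) ≤ 1)
    {ρ : V → ℕ} (hρ : Function.Injective ρ) (z X : V → Fin q) (a v : V) (F : Finset (Fin q))
    (hF : 1 ≤ #F * (2 / q : ℝ)) :
    ∑ c ∈ F, vertexPotential E ρ (Function.update z a c) X (ρ a + 1) v ≤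
      #F * vertexPotential E ρ z X (ρ a) v := by
  have hlt : ∀ u, u ≠ a → (ρ u < ρ a + 1 ↔ ρ u < ρ a) := fun u hu => by
    have : ρ u ≠ ρ a := fun h => hu (hρ h)
    omega
  by_cases hav : ρ a < ρ v
  · have hdis := pairwiseDisjoint_erase (F := {e ∈ E | v ∈ e})
      (fun e he f hf => hsimple e (mem_filter.1 he).1 f (mem_filter.1 hf).1) v
      (fun e he => (mem_filter.1 he).2)
    have h := sum_potential_update_le _ _ hdis (weight_nonneg ρ z X (ρ a) v) a
      (p := 2 / q) (fun c => by simp [weight, hav]) F hF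
    refine le_trans (le_of_eq (sum_congr rfl fun c' _ => ?_)) h
    unfold vertexPotential
    congr 1
    funext u
    by_cases hu : u = a
    · subst hu
      funext c
      simp [weight, hav]
    · funext c
      simp [weight, hu, hlt u hu]
  · rw [← nsmul_eq_mul, ← sum_const]
    refine le_of_eq (sum_congr rfl fun c' _ => ?_)
    unfold vertexPotential
    congr 1
    funext u c
    by_cases huv : ρ u < ρ v
    · have hu : u ≠ a := by rintro rfl; exact hav huv
      simp [weight, hu, hlt u hu]
    · simp [weight, huv]

theorem mixed_update {ρ : V → ℕ} (z X : V → Fin q) (a : V) (c : Fin q) {t : ℕ} (h : t ≤ ρ a) :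
    mixed ρ (Function.update z a c) X t = mixed ρ z X t := by
  funext u
  unfold mixed
  split_ifs with hu
  · rw [Function.update_of_ne]
    rintro rfl
    omega
  · rfl

/-- There is a coloring `z` to which both given colorings can be moved by giving the vertices, in
increasing order of rank, their color in `z`. -/
theorem exists_common_recoloring [Fintype V] (hq : 2 ≤ q) (hE : ∀ e ∈ E, 2 ≤ #e)
    (hsimple : ∀ e ∈ E, ∀ f ∈ E, e ≠ f → #(e ∩ f) ≤ 1)
    (ρ : V ≃ Fin (Fintype.card V)) (X : Bool → V → Fin q)
    (hX : ∀ b v, ∑ e ∈ E with v ∈ e, 2 * (2 / q : ℝ) ^ (#((e.erase v).image (X b)) - 1) ≤ q / 80)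
    (hn : 2 * (Fintype.card V : ℝ) ≤ Real.exp (q / 10)) :
    ∃ z : V → Fin q, ∀ b v,
      z v ∉ blocked E v (mixed (fun u => (ρ u : ℕ)) z (X b) (ρ v)) := by
  set r : V → ℕ := fun u => (ρ u : ℕ) with hr
  have hrinj : Function.Injective r := fun u v h => ρ.injective (Fin.ext h)
  have hq' : (2 : ℝ) ≤ q := by exact_mod_cast hq
  -- Method of conditional expectations: the total potential stays below exp(q/8) while the colors
  -- in `z` are fixed in order of rank.
  suffices H : ∀ t ≤ Fintype.card V, ∃ z : V → Fin q,
      (∀ b v, r v < t → z v ∉ blocked E v (mixed r z (X b) (r v))) ∧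
      ∑ b, ∑ v, vertexPotential E r z (X b) t v < Real.exp (q / 8) by
    obtain ⟨z, hz, -⟩ := H _ le_rfl
    exact ⟨z, fun b v => hz b v (ρ v).2⟩
  intro t
  induction t with
  | zero =>
    intro _
    -- Any coloring would do here: at time 0 the weights do not depend on `z`.
    refine ⟨X true, fun b v h => absurd h (Nat.not_lt_zero _), ?_⟩
    calc _ ≤ ∑ _b : Bool, ∑ _v : V, Real.exp (q / 80) := by
          refine sum_le_sum fun b _ => sum_le_sum fun v _ => ?_
          refine (vertexPotential_zero_le hq hE r _ _ v).trans ?_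
          exact Real.exp_le_exp.2 (hX b v)
      _ = 2 * (Fintype.card V : ℝ) * Real.exp (q / 80) := by
          simp [mul_assoc]
      _ ≤ Real.exp (q / 10) * Real.exp (q / 80) := by gcongr
      _ = Real.exp (q / 10 + q / 80) := by rw [Real.exp_add]
      _ < _ := by
          apply Real.exp_lt_exp.2
          linarith
  | succ t ih =>
    intro ht
    obtain ⟨z, hz, hpot⟩ := ih (by omega)
    set a : V := ρ.symm ⟨t, ht⟩ with ha
    have hra : r a = t := by simp [hr, ha]
    -- From exp(1/2) ≤ 2, the bound 2^B < exp(q/8) on the number B of blocked colors gives B < q/4.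
    have hblocked : ∀ b, 4 * (#(blocked E a (mixed r z (X b) (r a))) : ℝ) ≤ q := by
      intro b
      have h1 := two_pow_card_blocked_le hE r z (X b) a
      have h2 : vertexPotential E r z (X b) (r a) a ≤
          ∑ b, ∑ v, vertexPotential E r z (X b) t v := by
        rw [hra]
        refine le_trans ?_ (single_le_sum (f := fun b => ∑ v, vertexPotential E r z (X b) t v)
          (fun b _ => sum_nonneg fun v _ => vertexPotential_nonneg _ _ _ _ _) (mem_univ b))
        exact single_le_sum (f := fun v => vertexPotential E r z (X b) t v)
          (fun v _ => vertexPotential_nonneg _ _ _ _ _) (mem_univ a)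
      have h3 : Real.exp (1 / 2) ≤ 2 := by
        rw [← Real.le_log_iff_exp_le (by norm_num)]
        linarith [Real.log_two_gt_d9]
      have h4 : Real.exp ((#(blocked E a (mixed r z (X b) (r a))) : ℝ) * (1 / 2)) <
          Real.exp (q / 8) := by
        calc _ = Real.exp (1 / 2) ^ #(blocked E a (mixed r z (X b) (r a))) := by
              rw [Real.exp_nat_mul]
          _ ≤ 2 ^ #(blocked E a (mixed r z (X b) (r a))) := by gcongr
          _ < _ := (h1.trans h2).trans_lt hpot
      linarith [Real.exp_lt_exp.1 h4]
    set F := (univ.biUnion fun b => blocked E a (mixed r z (X b) (r a)))ᶜ with hFdef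
    have hFcard : (q : ℝ) ≤ 2 * #F := by
      have h1 : (#(univ.biUnion fun b => blocked E a (mixed r z (X b) (r a))) : ℝ) ≤
          ∑ b, (#(blocked E a (mixed r z (X b) (r a))) : ℝ) := by
        exact_mod_cast card_biUnion_le
      have h2 : (#(univ.biUnion fun b => blocked E a (mixed r z (X b) (r a))) : ℝ) + #F = q := by
        rw [hFdef]
        exact_mod_cast (card_add_card_compl _).trans (Fintype.card_fin q)
      rw [Fintype.sum_bool] at h1
      linarith [hblocked true, hblocked false]
    have hF : 1 ≤ #F * (2 / q : ℝ) := by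
      rw [mul_div_assoc', one_le_div (by linarith)]
      linarith
    have hFne : F.Nonempty := by
      rw [← card_pos]
      have : (0 : ℝ) < #F := by linarith
      exact_mod_cast this
    have hsum : ∑ c ∈ F, ∑ b, ∑ v,
        vertexPotential E r (Function.update z a c) (X b) (t + 1) v ≤
        ∑ _c ∈ F, ∑ b, ∑ v, vertexPotential E r z (X b) t v := by
      rw [sum_const, nsmul_eq_mul, sum_comm, mul_sum]
      refine sum_le_sum fun b _ => ?_
      rw [sum_comm, mul_sum]
      refine sum_le_sum fun v _ => ?_
      have := sum_vertexPotential_update_le hsimple hrinj z (X b) a v F hF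
      rwa [hra] at this
    obtain ⟨c, hc, hle⟩ := exists_le_of_sum_le hFne hsum
    refine ⟨Function.update z a c, fun b v hv => ?_, hle.trans_lt hpot⟩
    -- The new color of `a` is not seen by vertices of rank at most t, so their earlier choices
    -- remain available.
    rw [mixed_update _ _ _ _ (by omega)]
    by_cases hva : v = a
    · subst hva
      rw [Function.update_self]
      intro hcb
      exact mem_compl.1 hc (mem_biUnion.2 ⟨b, mem_univ _, hcb⟩)
    · rw [Function.update_of_ne hva]
      refine hz b v ?_
      have : r v ≠ t := fun h => hva (hrinj (h.trans hra.symm))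
      omega

end Recoloring

/-! ### Good colorings: abundance and small initial potential. -/

section Goodness

variable {V : Type*} [Fintype V] [DecidableEq V] {E : Finset (Finset V)} {q k : ℕ}

theorem eps_pos (hk : 0 < k) : 0 < eps k := by
  have : (0 : ℝ) < k := by exact_mod_cast hk
  unfold eps
  positivity

/-- All but a small proportion of the proper colorings are good. -/
theorem card_filter_not_good_le (hk : 3 ≤ k) (hn : 0 < Fintype.card V) {d : ℝ}
    (hE : ∀ e ∈ E, #e = k) (hsimple : ∀ e ∈ E, ∀ f ∈ E, e ≠ f → #(e ∩ f) ≤ 1)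
    (hd : ∀ v, (#{e ∈ E | v ∈ e} : ℝ) ≤ d) (hdq : 4 * k * d ≤ (q : ℝ) ^ (k - 1))
    (hdK : d ≤ (q / (500 * k ^ 3) : ℝ) ^ (k - 1)) (hq : 1 ≤ eps k * q)
    (hlog : 8 * Real.log (Fintype.card V) ≤ eps k * q) (P : (V → Fin q) → Prop)
    [DecidablePred P] (hP : ∀ X, P X → ∃ v : V, ∃ i ∈ Icc 1 (k - 2),
      (eps k * q) ^ i ≤ (#{e ∈ E | v ∈ e ∧ #((e.erase v).image X) = i} : ℝ)) :
    (#{X ∈ properOn E q univ | P X} : ℝ) ≤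
      k / Fintype.card V * #(properOn E q univ) := by
  have hk' : (3 : ℝ) ≤ k := by exact_mod_cast hk
  have hε := eps_pos (k := k) (by omega)
  have hε' : eps k = 1 / (50 * (k : ℝ) ^ 2) := rfl
  have hq0 : (0 : ℝ) < q := by
    by_contra h
    have : (q : ℝ) = 0 := le_antisymm (not_lt.1 h) (Nat.cast_nonneg q)
    rw [this] at hq
    norm_num at hq
  have hq0' : 0 < q := by exact_mod_cast hq0
  have hn' : (0 : ℝ) < Fintype.card V := by exact_mod_cast hn
  have hsub : ({X ∈ properOn E q univ | P X} : Finset _) ⊆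
      (univ ×ˢ Icc 1 (k - 2)).biUnion fun p => {X ∈ properOn E q univ |
        (eps k * q) ^ p.2 ≤ (#{e ∈ E | p.1 ∈ e ∧ #((e.erase p.1).image X) = p.2} : ℝ)} := by
    intro X hX
    obtain ⟨hX, hPX⟩ := mem_filter.1 hX
    obtain ⟨v, i, hi, h⟩ := hP X hPX
    exact mem_biUnion.2 ⟨(v, i), mem_product.2 ⟨mem_univ _, hi⟩, mem_filter.2 ⟨hX, h⟩⟩
  have hone : ∀ p ∈ (univ : Finset V) ×ˢ Icc 1 (k - 2), (#{X ∈ properOn E q univ |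
      (eps k * q) ^ p.2 ≤ (#{e ∈ E | p.1 ∈ e ∧ #((e.erase p.1).image X) = p.2} : ℝ)} : ℝ) ≤
      ((Fintype.card V : ℝ) ^ 2)⁻¹ * #(properOn E q univ) := by
    rintro ⟨v, i⟩ hp
    obtain ⟨hi1, hi2⟩ := mem_Icc.1 (mem_product.1 hp).2
    simp only at hi1 hi2 ⊢
    have hd0 : 0 ≤ d := (Nat.cast_nonneg _).trans (hd v)
    have hik : (i : ℝ) ≤ k := by exact_mod_cast (by omega : i ≤ k)
    refine (card_filter_le_of_le (k := k) (by omega) hq0' hE hsimple hd hdq v i ?_).trans ?_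
    -- With i ≤ k, the bound on `d` leaves k/(500k³) = ε/10 to the power k - 1, and the factor 1/10
    -- absorbs the constants.
    · calc 2 * (q : ℝ) ^ i * i ^ (k - 1) / q ^ (k - 1) * d
          ≤ 2 * (q : ℝ) ^ i * k ^ (k - 1) / q ^ (k - 1) *
            (q / (500 * k ^ 3) : ℝ) ^ (k - 1) := by gcongr
        _ = 2 * (q : ℝ) ^ i * (eps k / 10) ^ (k - 1) := by
            rw [mul_div_assoc, mul_assoc, ← div_pow, ← mul_pow, hε']
            congr 2
            field_simp
            norm_num
        _ ≤ 2 * (q : ℝ) ^ i * (eps k / 10) ^ i := by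
            gcongr 2 * (q : ℝ) ^ i * ?_
            refine pow_le_pow_of_le_one (by positivity) ?_ (by omega)
            rw [hε', div_div, div_le_one (by positivity)]
            nlinarith
        _ = 2 * (1 / 10) ^ i * (eps k * q) ^ i := by
            rw [mul_pow, div_eq_mul_one_div (eps k), mul_pow]; ring
        _ ≤ 2 * (1 / 10) ^ 1 * (eps k * q) ^ i := by
            gcongr ?_ * _
            exact mul_le_mul_of_nonneg_left
              (pow_le_pow_of_le_one (by norm_num) (by norm_num) hi1) (by norm_num)
        _ ≤ (eps k * q) ^ i / 4 := by
            have : 0 ≤ (eps k * q) ^ i := by positivity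
            linarith
    · gcongr
      have h1 : eps k * q ≤ (eps k * q) ^ i := le_self_pow₀ hq (by omega)
      calc _ ≤ Real.exp (-(2 * Real.log (Fintype.card V))) := by
            apply Real.exp_le_exp.2
            linarith
        _ = _ := by
            rw [Real.exp_neg, ← Nat.cast_two, Real.exp_nat_mul, Real.exp_log hn']
  have h1 : (#{X ∈ properOn E q univ | P X} : ℝ) ≤
      ∑ p ∈ (univ : Finset V) ×ˢ Icc 1 (k - 2), (#{X ∈ properOn E q univ |
      (eps k * q) ^ p.2 ≤ (#{e ∈ E | p.1 ∈ e ∧ #((e.erase p.1).image X) = p.2} : ℝ)} : ℝ) := by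
    exact_mod_cast (card_le_card hsub).trans card_biUnion_le
  refine h1.trans ((sum_le_card_nsmul _ _ _ hone).trans ?_)
  rw [card_product, Nat.card_Icc, card_univ, nsmul_eq_mul, Nat.cast_mul]
  have h2 : ((k - 2 + 1 - 1 : ℕ) : ℝ) ≤ k := by exact_mod_cast (by omega)
  calc _ ≤ (Fintype.card V : ℝ) * k * (((Fintype.card V : ℝ) ^ 2)⁻¹ * #(properOn E q univ)) := by
        gcongr
    _ = _ := by field_simp

omit [Fintype V] in
/-- Good colorings start with small potentials. -/
theorem sum_two_mul_pow_le (hk : 3 ≤ k) (hq : 0 < q) {d : ℝ} (hE : ∀ e ∈ E, #e = k)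
    (hd : ∀ v, (#{e ∈ E | v ∈ e} : ℝ) ≤ d) (hdε : d ≤ (eps k * q) ^ (k - 1)) {X : V → Fin q}
    (v : V) (hX : ∀ i ∈ Icc 1 (k - 2),
      (#{e ∈ E | v ∈ e ∧ #((e.erase v).image X) = i} : ℝ) ≤ (eps k * q) ^ i) :
    ∑ e ∈ E with v ∈ e, 2 * (2 / q : ℝ) ^ (#((e.erase v).image X) - 1) ≤ q / 80 := by
  have hk' : (3 : ℝ) ≤ k := by exact_mod_cast hk
  have hq' : (0 : ℝ) < q := by exact_mod_cast hq
  have hε := eps_pos (k := k) (by omega)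
  have hε' : eps k ≤ 1 / 450 := by
    unfold eps
    apply one_div_le_one_div_of_le (by norm_num)
    nlinarith
  have hmaps : ∀ e ∈ ({e ∈ E | v ∈ e} : Finset (Finset V)),
      #((e.erase v).image X) - 1 ∈ range (k - 1) := by
    intro e he
    obtain ⟨he, hve⟩ := mem_filter.1 he
    have h1 := card_image_le (f := X) (s := e.erase v)
    rw [card_erase_of_mem hve, hE e he] at h1
    exact mem_range.2 (by omega)
  have hpos : ∀ e ∈ E, v ∈ e → 0 < #((e.erase v).image X) := by
    intro e he hve
    rw [card_pos, image_nonempty, ← card_pos, card_erase_of_mem hve, hE e he]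
    omega
  rw [← sum_fiberwise_of_maps_to hmaps]
  have hterm : ∀ j ∈ range (k - 1), ∑ e ∈ {e ∈ E | v ∈ e} with #((e.erase v).image X) - 1 = j,
      2 * (2 / q : ℝ) ^ (#((e.erase v).image X) - 1) ≤ 2 * (eps k * q) * (1 / 2 : ℝ) ^ j := by
    intro j hj
    have hj' := mem_range.1 hj
    have hcount : (#{e ∈ ({e ∈ E | v ∈ e} : Finset (Finset V)) |
        #((e.erase v).image X) - 1 = j} : ℝ) ≤ (eps k * q) ^ (j + 1) := by
      by_cases h : j + 1 ≤ k - 2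
      · refine le_trans ?_ (hX (j + 1) (mem_Icc.2 ⟨by omega, h⟩))
        refine Nat.cast_le.2 (card_le_card fun e he => ?_)
        obtain ⟨he, h1⟩ := mem_filter.1 he
        obtain ⟨he, hve⟩ := mem_filter.1 he
        have := hpos e he hve
        exact mem_filter.2 ⟨he, hve, by omega⟩
      -- Goodness does not control edges that see k - 1 colors; there the degree bound suffices.
      · have : j + 1 = k - 1 := by omega
        rw [this]
        refine le_trans ?_ ((hd v).trans hdε)
        exact Nat.cast_le.2 (card_le_card (filter_subset _ _))
    calc _ = ∑ e ∈ {e ∈ E | v ∈ e} with #((e.erase v).image X) - 1 = j,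
          2 * (2 / q : ℝ) ^ j := by
          refine sum_congr rfl fun e he => ?_
          rw [(mem_filter.1 he).2]
      _ ≤ (eps k * q) ^ (j + 1) * (2 * (2 / q : ℝ) ^ j) := by
          rw [sum_const, nsmul_eq_mul]
          gcongr
      _ = 2 * (eps k * q) * (2 * eps k) ^ j := by
          rw [pow_succ]
          have : (eps k * q) ^ j * (2 / q : ℝ) ^ j = (2 * eps k) ^ j := by
            rw [← mul_pow]
            congr 1
            field_simp
          rw [← this]
          ring
      _ ≤ _ := by
          gcongr
          linarith
  refine (sum_le_sum hterm).trans ?_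
  rw [← mul_sum]
  have := sum_geometric_two_le (k - 1)
  calc _ ≤ 2 * (eps k * q) * 2 := by gcongr
    _ = 4 * eps k * q := by ring
    _ ≤ 4 * (1 / 450) * q := by gcongr
    _ ≤ _ := by linarith

end Goodness

/-! ### From hypergraphs to finsets of edges, and from recolorings to paths. -/

section Translation

variable {V : Type*} [Fintype V] (H : Hypergraph V)

open Classical in
/-- The edges of `H` as a finset of finsets. -/
noncomputable def edges : Finset (Finset V) := {e | (e : Set V) ∈ H.edgeSet}

variable {H} {q k : ℕ}

theorem mem_edges {e : Finset V} : e ∈ edges H ↔ (e : Set V) ∈ H.edgeSet := by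
  simp [edges]

theorem exists_edge_iff {P : Set V → Prop} :
    (∃ e ∈ H.edgeSet, P e) ↔ ∃ e ∈ edges H, P e := by
  constructor
  · rintro ⟨e, he, h⟩
    exact ⟨e.toFinite.toFinset, mem_edges.2 (by simpa), by simpa⟩
  · rintro ⟨e, he, h⟩
    exact ⟨e, mem_edges.1 he, h⟩

theorem ncard_edges_eq (P : Set V → Prop) [DecidablePred fun e : Finset V => P e] :
    {e ∈ H.edgeSet | P e}.ncard = #{e ∈ edges H | P (e : Finset V)} := by
  rw [← Set.ncard_coe_finset, ← Set.ncard_image_of_injective _ coe_injective]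
  congr 1
  ext e
  simp only [Set.mem_ofPred_eq, coe_filter, Set.mem_image]
  constructor
  · rintro ⟨he, h⟩
    exact ⟨e.toFinite.toFinset, ⟨mem_edges.2 (by simpa), by simpa⟩, by simp⟩
  · rintro ⟨f, ⟨hf, h⟩, rfl⟩
    exact ⟨mem_edges.1 hf, h⟩

theorem IsUniform.card_eq (h : IsUniform H k) : ∀ e ∈ edges H, #e = k := fun e he => by
  rw [← h _ (mem_edges.1 he), Set.ncard_coe_finset]

variable [DecidableEq V]

theorem IsSimple.card_inter_le (h : IsSimple H) :
    ∀ e ∈ edges H, ∀ f ∈ edges H, e ≠ f → #(e ∩ f) ≤ 1 := fun e he f hf hef => by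
  have := h _ (mem_edges.1 he) _ (mem_edges.1 hf) (fun h => hef (coe_injective h))
  rwa [← coe_inter, Set.ncard_coe_finset] at this

theorem degree_eq (v : V) : degree H v = #{e ∈ edges H | v ∈ e} := by
  unfold degree
  rw [ncard_edges_eq (fun e => v ∈ e)]
  simp

theorem colorCount_eq (v : V) (i : ℕ) (X : V → Fin q) :
    colorCount H v i X = #{e ∈ edges H | v ∈ e ∧ #((e.erase v).image X) = i} := by
  classical
  unfold colorCount
  rw [ncard_edges_eq (fun e => v ∈ e ∧ (X '' (e \ {v})).ncard = i)]
  congr 1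
  refine filter_congr fun e _ => ?_
  rw [← coe_erase, ← coe_image, Set.ncard_coe_finset, mem_coe]

theorem mem_unavailable_iff {v : V} {X : V → Fin q} {c : Fin q} :
    c ∈ unavailable H v X ↔ c ∈ blocked (edges H) v X := by
  have := exists_edge_iff (H := H) (P := fun e => v ∈ e ∧ ∀ x ∈ e \ {v}, X x = c)
  simp only [blocked, mem_filter, mem_univ, true_and]
  refine this.trans (exists_congr fun e => ?_)
  rw [← coe_erase]
  rfl

theorem mem_properOn_univ_iff (hk : 0 < k) (h : IsUniform H k) {X : V → Fin q} :
    X ∈ properOn (edges H) q univ ↔ IsProper H X := by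
  constructor
  · intro hX e he
    by_contra! hc
    obtain ⟨f, rfl⟩ : ∃ f : Finset V, (f : Set V) = e := ⟨e.toFinite.toFinset, by simp⟩
    have hf := mem_edges.2 he
    obtain ⟨x, hx⟩ : f.Nonempty := by
      rw [← card_pos, h.card_eq f hf]; exact hk
    refine mem_properOn.1 hX f hf (subset_univ _) (card_eq_one.2 ⟨X x, ?_⟩)
    refine eq_singleton_iff_unique_mem.2 ⟨mem_image_of_mem _ hx, fun c hc' => ?_⟩
    obtain ⟨y, hy, rfl⟩ := mem_image.1 hc'
    exact hc y hy x hx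
  · intro hX
    refine mem_properOn.2 fun e he _ h1 => ?_
    obtain ⟨x, hx, y, hy, hxy⟩ := hX e (mem_edges.1 he)
    exact hxy (card_le_one.1 h1.le _ (mem_image_of_mem _ hx) _ (mem_image_of_mem _ hy))

omit [Fintype V] in
theorem IsProper.update {X : V → Fin q} (hX : IsProper H X) {v : V} {c : Fin q}
    (hc : c ∈ available H v X) : IsProper H (Function.update X v c) := by
  intro e he
  by_cases hv : v ∈ e
  · by_contra! h
    refine hc ⟨e, he, hv, fun x hx => ?_⟩
    have := h x hx.1 v hv
    rwa [Function.update_self, Function.update_of_ne hx.2] at this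
  · obtain ⟨x, hx, y, hy, hxy⟩ := hX e he
    refine ⟨x, hx, y, hy, ?_⟩
    rwa [Function.update_of_ne (ne_of_mem_of_not_mem hx hv),
      Function.update_of_ne (ne_of_mem_of_not_mem hy hv)]

theorem exists_walk_mixed (ρ : V ≃ Fin (Fintype.card V)) (X : ProperColoring H q)
    (z : V → Fin q)
    (hz : ∀ v, z v ∈ available H v (mixed (fun u => (ρ u : ℕ)) z X.1 (ρ v))) (t : ℕ)
    (ht : t ≤ Fintype.card V) :
    ∃ h : IsProper H (mixed (fun u => (ρ u : ℕ)) z X.1 t),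
      ∃ p : (glauberGraph H q).Walk X ⟨_, h⟩, p.length ≤ t := by
  induction t with
  | zero =>
    have h0 : mixed (fun u => (ρ u : ℕ)) z X.1 0 = X.1 := by
      funext u
      simp [mixed]
    refine ⟨h0 ▸ X.2, SimpleGraph.Walk.nil.copy rfl (Subtype.ext h0.symm), by simp⟩
  | succ t ih =>
    obtain ⟨h, p, hp⟩ := ih (by omega)
    set a : V := ρ.symm ⟨t, ht⟩ with ha
    have hra : (ρ a : ℕ) = t := by simp [ha]
    have hza := hz a
    rw [hra] at hza
    have hstep : mixed (fun u => (ρ u : ℕ)) z X.1 (t + 1) =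
        Function.update (mixed (fun u => (ρ u : ℕ)) z X.1 t) a (z a) := by
      funext u
      by_cases hu : u = a
      · subst hu
        simp [mixed, hra]
      · have : (ρ u : ℕ) ≠ t := fun h => hu (ρ.injective (Fin.ext (h.trans hra.symm)))
        rw [Function.update_of_ne hu]
        have : (ρ u : ℕ) < t + 1 ↔ (ρ u : ℕ) < t := by omega
        simp [mixed, this]
    have h' : IsProper H (mixed (fun u => (ρ u : ℕ)) z X.1 (t + 1)) := by
      rw [hstep]
      exact h.update hza
    refine ⟨h', ?_⟩
    -- A vertex that already has its target color gives no edge of the graph, so the walk stays put.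
    by_cases heq : mixed (fun u => (ρ u : ℕ)) z X.1 (t + 1) = mixed (fun u => (ρ u : ℕ)) z X.1 t
    · exact ⟨p.copy rfl (Subtype.ext heq.symm), by simpa using hp.trans (Nat.le_succ t)⟩
    · have hadj : (glauberGraph H q).Adj ⟨_, h⟩ ⟨_, h'⟩ := (SimpleGraph.fromRel_adj _ _ _).2
        ⟨fun hne => heq (congrArg Subtype.val hne).symm, Or.inl ⟨a, z a, hza, hstep⟩⟩
      refine ⟨p.concat hadj, ?_⟩
      rw [SimpleGraph.Walk.length_concat]
      omega

/-- Two colorings that can be moved to a common coloring are joined by a short path. -/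
theorem exists_path_of_common_recoloring (ρ : V ≃ Fin (Fintype.card V))
    (X Y : ProperColoring H q) (z : V → Fin q)
    (hzX : ∀ v, z v ∈ available H v (mixed (fun u => (ρ u : ℕ)) z X.1 (ρ v)))
    (hzY : ∀ v, z v ∈ available H v (mixed (fun u => (ρ u : ℕ)) z Y.1 (ρ v))) :
    ∃ p : (glauberGraph H q).Walk X Y, p.IsPath ∧ p.length ≤ 2 * Fintype.card V := by
  classical
  obtain ⟨hX, p, hp⟩ := exists_walk_mixed ρ X z hzX _ le_rfl
  obtain ⟨hY, p', hp'⟩ := exists_walk_mixed ρ Y z hzY _ le_rfl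
  have hXY : mixed (fun u => (ρ u : ℕ)) z X.1 (Fintype.card V) =
      mixed (fun u => (ρ u : ℕ)) z Y.1 (Fintype.card V) := by
    funext u
    simp [mixed]
  refine ⟨(p.append (p'.reverse.copy (Subtype.ext hXY.symm) rfl)).bypass,
    SimpleGraph.Walk.bypass_isPath _, (SimpleGraph.Walk.length_bypass_le_length _).trans ?_⟩
  simp only [SimpleGraph.Walk.length_append, SimpleGraph.Walk.length_copy,
    SimpleGraph.Walk.length_reverse]
  omega

theorem card_filter_edges_le (v : V) : (#{e ∈ edges H | v ∈ e} : ℝ) ≤ maxDegree H := by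
  rw [← degree_eq]
  exact_mod_cast le_sup (f := degree H) (mem_univ v)

theorem card_properColoring (hk : 0 < k) (hunif : IsUniform H k) :
    Nat.card (ProperColoring H q) = #(properOn (edges H) q univ) :=
  Nat.subtype_card _ fun _ => mem_properOn_univ_iff hk hunif

theorem one_sub_mul_card_le_ncard_isGood (hk : 3 ≤ k) (hn : 0 < Fintype.card V)
    (hunif : IsUniform H k) (hsimp : IsSimple H)
    (hdq : 4 * k * (maxDegree H : ℝ) ≤ (q : ℝ) ^ (k - 1))
    (hdK : maxDegree H ≤ (q / (500 * k ^ 3) : ℝ) ^ (k - 1)) (hq : 1 ≤ eps k * q)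
    (hlog : 8 * Real.log (Fintype.card V) ≤ eps k * q) :
    (1 - k / Fintype.card V : ℝ) * Nat.card (ProperColoring H q) ≤
      ({X : ProperColoring H q | IsGood H k X.1}.ncard : ℝ) := by
  classical
  have h1 := card_filter_not_good_le hk hn hunif.card_eq hsimp.card_inter_le
    card_filter_edges_le hdq hdK hq hlog (fun X : V → Fin q => ¬ IsGood H k X) (fun X hX => by
      simp only [IsGood, not_forall, not_lt, exists_prop] at hX
      obtain ⟨v, i, hi1, hi2, h⟩ := hX
      exact ⟨v, i, mem_Icc.2 ⟨hi1, hi2⟩, by rwa [← colorCount_eq]⟩)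
  have h2 := card_filter_add_card_filter_not (s := properOn (edges H) q univ)
    (fun X : V → Fin q => IsGood H k X)
  have h3 : {X : ProperColoring H q | IsGood H k X.1}.ncard =
      #{X ∈ properOn (edges H) q univ | IsGood H k X} := by
    rw [← Set.ncard_coe_finset, ← Set.ncard_image_of_injective _ Subtype.val_injective]
    congr 1
    ext X
    simp only [Set.mem_image, Set.mem_ofPred_eq, coe_filter,
      mem_properOn_univ_iff (q := q) (by omega : 0 < k) hunif]
    exact ⟨by rintro ⟨Y, hY, rfl⟩; exact ⟨Y.2, hY⟩, fun h => ⟨⟨X, h.1⟩, h.2, rfl⟩⟩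
  rw [h3, card_properColoring (by omega) hunif]
  have h4 : (#{X ∈ properOn (edges H) q univ | IsGood H k X} : ℝ) +
      #{X ∈ properOn (edges H) q univ | ¬ IsGood H k X} = #(properOn (edges H) q univ) := by
    exact_mod_cast h2
  linarith

/-- Good proper colorings are joined by paths of linear length. -/
theorem exists_path_of_isGood (hk : 3 ≤ k) (hq : 2 ≤ q) (hunif : IsUniform H k)
    (hsimp : IsSimple H) (hdε : maxDegree H ≤ (eps k * q) ^ (k - 1))
    (hn : 2 * (Fintype.card V : ℝ) ≤ Real.exp (q / 10)) (X Y : ProperColoring H q)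
    (hX : IsGood H k X.1) (hY : IsGood H k Y.1) :
    ∃ p : (glauberGraph H q).Walk X Y, p.IsPath ∧ p.length ≤ 2 * Fintype.card V := by
  have hE := hunif.card_eq
  have hsum : ∀ X : V → Fin q, IsGood H k X → ∀ v, ∑ e ∈ edges H with v ∈ e,
      2 * (2 / q : ℝ) ^ (#((e.erase v).image X) - 1) ≤ q / 80 := fun X hX v =>
    sum_two_mul_pow_le hk (by omega) hE card_filter_edges_le hdε v fun i hi => by
      rw [← colorCount_eq]
      exact (hX v i (mem_Icc.1 hi).1 (mem_Icc.1 hi).2).le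
  obtain ⟨z, hz⟩ := exists_common_recoloring hq (fun e he => by rw [hE e he]; omega)
    hsimp.card_inter_le (Fintype.equivFin V) (fun b => if b then X.1 else Y.1)
    (fun b v => by
      cases b
      · exact hsum _ hY v
      · exact hsum _ hX v) hn
  exact exists_path_of_common_recoloring (Fintype.equivFin V) X Y z
    (fun v h => hz true v (mem_unavailable_iff.1 h))
    (fun v h => hz false v (mem_unavailable_iff.1 h))

end Translation

end HypergraphColoring

/-! ### Choice of constants and conclusion. -/

theorem corollary1 (k : ℕ) (hk : 3 ≤ k) :
    ∃ C D : ℝ, ∀ δ : ℝ, 0 < δ → ∃ N : ℕ,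
      ∀ (V : Type u) [Fintype V] [DecidableEq V] (H : Hypergraph V) (q : ℕ),
        H.vertexSet = Set.univ →
        IsUniform H k →
        IsSimple H →
        N ≤ Fintype.card V →
        q ≤ 2 * maxDegree H →
        max (C * Real.log (Fintype.card V))
          (10 * k * (eps k)⁻¹ * (maxDegree H : ℝ) ^ (1 / ((k : ℝ) - 1))) ≤ q →
        -- there is a component containing all but a fraction `δ` of the proper colorings
        (∃ Q₀ : (glauberGraph H q).ConnectedComponent,
          (1 - δ) * Nat.card (ProperColoring H q) ≤ (Q₀.supp.ncard : ℝ)) ∧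
        -- any two good proper colorings are joined by a path of length `O(n log n)`
        (∀ X Y : ProperColoring H q, IsGood H k X.1 → IsGood H k Y.1 →
          ∃ p : (glauberGraph H q).Walk X Y, p.IsPath ∧
            (p.length : ℝ) ≤ D * (Fintype.card V * Real.log (Fintype.card V))) ∧
        -- all but a fraction `δ` of the proper colorings are good
        (1 - δ) * Nat.card (ProperColoring H q) ≤
          ({X : ProperColoring H q | IsGood H k X.1}.ncard : ℝ) := by
  have hk' : (3 : ℝ) ≤ k := by exact_mod_cast hk
  -- 400k² = 8/ε makes 8 log n ≤ εq; n ≥ k/δ makes the proportion k/n of bad colorings at most δ; n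
  -- ≥ 3 gives log n ≥ 1, so the length bound 2n is at most 2n log n.
  refine ⟨400 * (k : ℝ) ^ 2, 2, fun δ hδ => ⟨max 3 ⌈k / δ⌉₊, ?_⟩⟩
  intro V _ _ H q _ hunif hsimp hN _ hq
  have hn3 : 3 ≤ Fintype.card V := (le_max_left _ _).trans hN
  have hnδ : (k : ℝ) / δ ≤ Fintype.card V :=
    (Nat.le_ceil _).trans (by exact_mod_cast (le_max_right _ _).trans hN)
  set n : ℝ := (Fintype.card V : ℝ) with hn
  have hn3' : (3 : ℝ) ≤ n := by rw [hn]; exact_mod_cast hn3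
  have hlog1 : 1 ≤ Real.log n := by
    rw [Real.le_log_iff_exp_le (by linarith)]
    linarith [Real.exp_one_lt_d9]
  have hqlog := (le_max_left _ _).trans hq
  have hqΔ := (le_max_right _ _).trans hq
  have hε : eps k = 1 / (50 * (k : ℝ) ^ 2) := rfl
  have hεpos := eps_pos (k := k) (by omega)
  have hεq : 8 * Real.log n ≤ eps k * q := by
    calc 8 * Real.log n = eps k * (400 * (k : ℝ) ^ 2 * Real.log n) := by
          rw [hε]; field_simp; norm_num
      _ ≤ _ := by gcongr
  have hq3600 : 3600 * Real.log n ≤ q := by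
    refine le_trans ?_ hqlog
    gcongr
    nlinarith
  have hq2 : 2 ≤ q := by
    have : (2 : ℝ) ≤ q := by linarith
    exact_mod_cast this
  have hq0 : (0 : ℝ) < q := by linarith
  set Δ : ℝ := (maxDegree H : ℝ) with hΔ
  have hdK : Δ ≤ (q / (500 * k ^ 3) : ℝ) ^ (k - 1) := by
    -- Here 500k³ is 10k/ε.
    have h1 : Δ ^ (1 / ((k : ℝ) - 1)) ≤ q / (500 * k ^ 3) := by
      rw [le_div_iff₀ (by positivity)]
      refine le_trans (le_of_eq ?_) hqΔ
      rw [hε]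
      field_simp
      ring
    have h2 : ((k - 1 : ℕ) : ℝ) = (k : ℝ) - 1 := by
      rw [Nat.cast_sub (by omega), Nat.cast_one]
    calc Δ = (Δ ^ (((k - 1 : ℕ) : ℝ)⁻¹)) ^ (k - 1) :=
          (Real.rpow_inv_natCast_pow (Nat.cast_nonneg _) (by omega)).symm
      _ ≤ _ := by
          rw [h2, ← one_div]
          gcongr
  have hdε : Δ ≤ (eps k * q) ^ (k - 1) := by
    refine hdK.trans ?_
    gcongr
    rw [hε, div_mul_eq_mul_div, one_mul]
    refine div_le_div_of_nonneg_left hq0.le (by positivity) ?_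
    nlinarith [sq_nonneg (k : ℝ)]
  have hdq : 4 * k * Δ ≤ (q : ℝ) ^ (k - 1) := by
    rw [div_pow, le_div_iff₀ (by positivity)] at hdK
    refine le_trans ?_ hdK
    rw [mul_comm]
    gcongr
    have h1 : (500 * (k : ℝ) ^ 3) ≤ (500 * (k : ℝ) ^ 3) ^ (k - 1) := by
      refine le_self_pow₀ ?_ (by omega)
      nlinarith [pow_le_pow_left₀ (by norm_num) hk' 3]
    refine le_trans ?_ h1
    nlinarith [pow_le_pow_left₀ (by norm_num) hk' 2, pow_pos (by linarith : (0 : ℝ) < k) 3]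
  have hgood : (1 - δ) * Nat.card (ProperColoring H q) ≤
      ({X : ProperColoring H q | IsGood H k X.1}.ncard : ℝ) := by
    refine le_trans ?_ (one_sub_mul_card_le_ncard_isGood hk (by omega) hunif hsimp hdq hdK
      (by linarith) hεq)
    gcongr
    rw [div_le_iff₀ (by linarith), mul_comm, ← div_le_iff₀ hδ]
    exact hnδ
  have hexp : 2 * n ≤ Real.exp (q / 10) := by
    have hlog2 : Real.log 2 ≤ Real.log n := Real.log_le_log (by norm_num) (by linarith)
    rw [← Real.log_le_iff_le_exp (by linarith), Real.log_mul (by norm_num) (by linarith)]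
    linarith
  have hpath := exists_path_of_isGood hk hq2 hunif hsimp hdε hexp
  refine ⟨?_, fun X Y hX hY => ?_, hgood⟩
  · by_cases h : ∃ X : ProperColoring H q, IsGood H k X.1
    · obtain ⟨X, hX⟩ := h
      refine ⟨(glauberGraph H q).connectedComponentMk X, hgood.trans ?_⟩
      refine Nat.cast_le.2 (Set.ncard_le_ncard fun Y hY => ?_)
      obtain ⟨p, -⟩ := hpath Y X hY hX
      exact SimpleGraph.ConnectedComponent.sound p.reachable
    · push Not at h
      -- Without good colorings `hgood` bounds (1 - δ)|𝒬| by 0, so any component will do; one exists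
      -- because a proper coloring does.
      obtain ⟨X, hX⟩ := properOn_univ_nonempty (by omega) (by omega) hunif.card_eq
        card_filter_edges_le hdq
      refine ⟨(glauberGraph H q).connectedComponentMk
        ⟨X, (mem_properOn_univ_iff (by omega) hunif).1 hX⟩, hgood.trans ?_⟩
      simp [h]
  · obtain ⟨p, hp, hlen⟩ := hpath X Y hX hY
    refine ⟨p, hp, ?_⟩
    calc (p.length : ℝ) ≤ 2 * n := by rw [hn]; exact_mod_cast hlen
      _ ≤ 2 * (n * Real.log n) := by
          gcongr
          exact le_mul_of_one_le_right (by linarith) hlog1
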